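/- Let $S$ be a countable right LCM semigroup, i.e. a countable left cancellative monoid such that for all $s,t\in S$ either $sS\cap tS=\emptyset$ or $sS\cap tS=rS$ for some $r\in S$. Let $N\colon S\to[1,+\infty)$ be a scale, i.e. a homomorphism into the multiplicative monoid $[1,+\infty)$, and assume that $N$ is nontrivial (not identically $1$). Put $\ker N=N^{-1}(1)$ and let $\beta\in\mathbb R$. For $s\in S$ let $\lambda_s\colon S\to sS$, $t\mapsto st$, viewed as a partial bijection of $S$, let $e_s=\lambda_s\lambda_s^{-1}$, and let $E(S)=\{e_s : s\in S\}\cup\{0\}$ be the semilattice of these idempotents under composition. Let $\widehat{E(S)}$ be the compact space (topology of pointwise convergence) of nonzero semigroup homomorphisms $\chi\colon E(S)\to\{0,1\}$ with $\chi(0)=0$, and put $(\lambda_s\cdot\chi)(e)=\chi(\lambda_s^{-1}e\lambda_s)$. Let $C^*(S)$ be the universal unital C$^*$-algebra generated by isometries $v_s$, $s\in S$, such that $v_e=1$, $v_sv_t=v_{st}$, $v_sv_s^*v_tv_t^*=v_rv_r^*$ if $sS\cap tS=rS$, and $v_sv_s^*v_tv_t^*=0$ if $sS\cap tS=\emptyset$;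 let $\sigma^N$ be the dynamics on it with $\sigma^N_t(v_s)=N(s)^{it}v_s$. A $\sigma^N$-KMS$_\beta$-state is a state $\varphi$ on $C^*(S)$ such that $\varphi(ab)=\varphi(b\,\sigma^N_{i\beta}(a))$ for all $a,b$ in some dense $\sigma^N$-invariant subspace of $\sigma^N$-analytic elements (elements $a$ for which $t\mapsto\sigma^N_t(a)$ extends to an entire function $z\mapsto \sigma^N_z(a)$). Suppose that at least one of the following holds: (a) there is a Borel probability measure $\mu$ on $\widehat{E(S)}$ such that $\mu(\lambda_s\cdot A)=N(s)^{-\beta}\mu(A)$ for all $s\in S$ and all Borel sets $A\subset\widehat{E(S)}$; (b) there is a $\sigma^N$-KMS$_\beta$-state on $C^*(S)$. Then either $\beta=0$, or $\beta>0$ and the following condition is satisfied: for all $s\in S$ and $t\in\ker N$ we have $sS\cap tS=rS$ for some $r\in s(\ker N)$. -/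

import Mathlib

open scoped ENNReal ComplexOrder

noncomputable section

namespace RightLCM

universe u

/-! ### Right LCM semigroups and scales -/

/-- The principal right ideal `sS`. -/
def rightIdeal {S : Type u} [Monoid S] (s : S) : Set S := {x | ∃ y, s * y = x}

/-- A left cancellative monoid is right LCM if the intersection of any two principal right ideals
is either empty or again a principal right ideal. -/
class IsRightLCM (S : Type u) [Monoid S] [IsLeftCancelMul S] : Prop where
  inter (s t : S) : rightIdeal s ∩ rightIdeal t = ∅ ∨
    ∃ r, rightIdeal s ∩ rightIdeal t = rightIdeal r

/-- A scale is a homomorphism `N : S → ([1, +∞), ·)`. -/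
structure Scale (S : Type u) [Monoid S] extends S →* ℝ where
  one_le (s : S) : 1 ≤ toFun s

instance {S : Type u} [Monoid S] : CoeFun (Scale S) (fun _ => S → ℝ) := ⟨fun N => N.toFun⟩

/-- The scale is not identically `1`. -/
def Scale.Nontrivial {S : Type u} [Monoid S] (N : Scale S) : Prop := ∃ s, N s ≠ 1

/-- The naive kernel `N⁻¹(1)`. -/
def Scale.ker {S : Type u} [Monoid S] (N : Scale S) : Set S := {s | N s = 1}

/-- For all `s ∈ S` and `t ∈ ker N` we have `sS ∩ tS = rS` for some `r ∈ s (ker N)`. -/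
def Scale.Admissible {S : Type u} [Monoid S] (N : Scale S) : Prop :=
  ∀ s : S, ∀ t ∈ N.ker, ∃ r ∈ (fun k => s * k) '' N.ker,
    rightIdeal s ∩ rightIdeal t = rightIdeal r

/-! ### The semilattice `E(S)` of idempotents of the left inverse hull -/

/-- The composition `x ∘ y` of partial bijections (first `y`, then `x`), on its natural domain. -/
def comp {S : Type u} (x y : S ≃. S) : S ≃. S := y.trans x

theorem comp_eq_some {S : Type u} {x y : S ≃. S} {a c : S} :
    comp x y a = some c ↔ ∃ b, y a = some b ∧ x b = some c :=
  PEquiv.trans_eq_some y x a c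

theorem pequiv_ext {S : Type u} {x y : S ≃. S} (h : ∀ a b, x a = some b ↔ y a = some b) : x = y :=
  PEquiv.ext fun a => Option.ext fun b => h a b

section Semilattice

variable {S : Type u} [Monoid S] [IsLeftCancelMul S]

open Classical in
/-- The partial bijection `λ_s : S → sS`, `t ↦ st`. -/
def lam (s : S) : S ≃. S where
  toFun t := some (s * t)
  invFun x := if h : ∃ t, s * t = x then some h.choose else none
  inv a b := by
    constructor
    · intro h
      split_ifs at h with hb
      have h1 := hb.choose_spec
      rw [Option.some.injEq] at h
      rw [h] at h1
      rw [h1]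
    · intro h
      rw [Option.some.injEq] at h
      have hb : ∃ t, s * t = b := ⟨a, h⟩
      rw [dif_pos hb, Option.some.injEq]
      exact mul_left_cancel (hb.choose_spec.trans h.symm)

/-- The idempotent `e_s = λ_s λ_s⁻¹`. -/
def idem (s : S) : S ≃. S := comp (lam s) (lam s).symm

theorem lam_eq_some {s a b : S} : lam s a = some b ↔ s * a = b := by
  change some (s * a) = some b ↔ _
  rw [Option.some.injEq]

theorem lam_symm_eq_some {s a b : S} : (lam s).symm b = some a ↔ s * a = b := by
  rw [PEquiv.eq_some_iff, lam_eq_some]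

theorem idem_eq_some {s a b : S} : idem s a = some b ↔ a = b ∧ a ∈ rightIdeal s := by
  unfold idem
  rw [comp_eq_some]
  simp only [lam_eq_some, lam_symm_eq_some, rightIdeal, Set.mem_ofPred_eq]
  constructor
  · rintro ⟨c, h1, h2⟩
    exact ⟨h1.symm.trans h2, c, h1⟩
  · rintro ⟨rfl, c, h⟩
    exact ⟨c, h, h⟩

variable (S) in
/-- `E(S) = {e_s | s ∈ S} ∪ {0}`, where `0 = ⊥` is the empty partial bijection. -/
def Idem : Type u := {x : S ≃. S // (∃ s, x = idem s) ∨ x = ⊥}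

instance : Zero (Idem S) := ⟨⟨⊥, Or.inr rfl⟩⟩

/-- The element `e_s` of `E(S)`. -/
def Idem.mk (s : S) : Idem S := ⟨idem s, Or.inl ⟨s, rfl⟩⟩

theorem comp_idem_mem [IsRightLCM S] (s t : S) :
    (∃ r, comp (idem s) (idem t) = idem r) ∨ comp (idem s) (idem t) = ⊥ := by
  have key : ∀ a b, comp (idem s) (idem t) a = some b ↔
      a = b ∧ a ∈ rightIdeal s ∩ rightIdeal t := by
    intro a b
    rw [comp_eq_some]
    simp only [idem_eq_some, Set.mem_inter_iff]
    constructor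
    · rintro ⟨c, ⟨rfl, h1⟩, rfl, h2⟩
      exact ⟨rfl, h2, h1⟩
    · rintro ⟨rfl, h1, h2⟩
      exact ⟨a, ⟨rfl, h2⟩, rfl, h1⟩
  rcases IsRightLCM.inter s t with h | ⟨r, h⟩
  · right
    apply pequiv_ext
    intro a b
    rw [key, h]
    simp
  · left
    refine ⟨r, pequiv_ext fun a b => ?_⟩
    rw [key, h, idem_eq_some]

/-- Multiplication in `E(S)` is composition of partial bijections. -/
instance [IsRightLCM S] : Mul (Idem S) where
  mul e f := ⟨comp e.1 f.1, by
    rcases e with ⟨e, ⟨s, rfl⟩ | rfl⟩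
    · rcases f with ⟨f, ⟨t, rfl⟩ | rfl⟩
      · exact comp_idem_mem s t
      · exact Or.inr (PEquiv.bot_trans _)
    · exact Or.inr (PEquiv.trans_bot _)⟩

theorem conj_mem [IsRightLCM S] (s t : S) :
    (∃ r, comp (lam s).symm (comp (idem t) (lam s)) = idem r) ∨
      comp (lam s).symm (comp (idem t) (lam s)) = ⊥ := by
  have key : ∀ a b, comp (lam s).symm (comp (idem t) (lam s)) a = some b ↔
      a = b ∧ s * a ∈ rightIdeal s ∩ rightIdeal t := by
    intro a b
    rw [comp_eq_some]
    simp only [comp_eq_some, lam_symm_eq_some, lam_eq_some, idem_eq_some, Set.mem_inter_iff]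
    constructor
    · rintro ⟨c, ⟨d, rfl, rfl, h⟩, h2⟩
      exact ⟨mul_left_cancel h2.symm, ⟨a, rfl⟩, h⟩
    · rintro ⟨rfl, -, h⟩
      exact ⟨s * a, ⟨s * a, rfl, rfl, h⟩, rfl⟩
  rcases IsRightLCM.inter s t with h | ⟨r, h⟩
  · right
    apply pequiv_ext
    intro a b
    rw [key, h]
    simp
  · left
    have hr : r ∈ rightIdeal s ∩ rightIdeal t := by
      rw [h]; exact ⟨1, mul_one r⟩
    obtain ⟨q, rfl⟩ := hr.1
    refine ⟨q, pequiv_ext fun a b => ?_⟩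
    rw [key, h, idem_eq_some]
    refine and_congr_right fun _ => ?_
    constructor
    · rintro ⟨y, hy⟩
      exact ⟨y, mul_left_cancel ((mul_assoc s q y).symm.trans hy)⟩
    · rintro ⟨y, rfl⟩
      exact ⟨y, mul_assoc s q y⟩

/-- The map `e ↦ λ_s⁻¹ e λ_s` on `E(S)`. -/
def Idem.conj [IsRightLCM S] (s : S) (e : Idem S) : Idem S :=
  ⟨comp (lam s).symm (comp e.1 (lam s)), by
    rcases e with ⟨e, ⟨t, rfl⟩ | rfl⟩
    · exact conj_mem s t
    · right
      simp [comp]⟩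

theorem Idem.conj_zero [IsRightLCM S] (s : S) : Idem.conj s (0 : Idem S) = 0 := by
  apply Subtype.ext
  change comp (lam s).symm (comp ⊥ (lam s)) = ⊥
  simp [comp]

theorem Idem.conj_mul [IsRightLCM S] (s : S) (e f : Idem S) :
    Idem.conj s (e * f) = Idem.conj s e * Idem.conj s f := by
  have diag : ∀ (e : Idem S) (a b : S), e.1 a = some b → a = b := by
    rintro ⟨e, ⟨t, rfl⟩ | rfl⟩ a b h
    · exact (idem_eq_some.1 h).1
    · simp at h
  apply Subtype.ext
  change comp (lam s).symm (comp (comp e.1 f.1) (lam s)) =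
    comp (comp (lam s).symm (comp e.1 (lam s))) (comp (lam s).symm (comp f.1 (lam s)))
  apply pequiv_ext
  intro a b
  simp only [comp_eq_some, lam_symm_eq_some, lam_eq_some]
  constructor
  · rintro ⟨c, ⟨d, rfl, d', h1, h2⟩, h3⟩
    have h4 := diag f _ _ h1
    subst h4
    exact ⟨a, ⟨s * a, ⟨_, rfl, h1⟩, rfl⟩, c, ⟨_, rfl, h2⟩, h3⟩
  · rintro ⟨b', ⟨c', ⟨_, rfl, h1⟩, h2⟩, c, ⟨_, rfl, h4⟩, h5⟩
    subst h2
    exact ⟨c, ⟨_, rfl, _, h1, h4⟩, h5⟩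

theorem Idem.mk_one_mul [IsRightLCM S] (e : Idem S) : Idem.mk (1 : S) * e = e := by
  apply Subtype.ext
  change comp (idem 1) e.1 = e.1
  apply pequiv_ext
  intro a b
  rw [comp_eq_some]
  constructor
  · rintro ⟨c, h1, h2⟩
    rw [(idem_eq_some.1 h2).1] at h1
    exact h1
  · intro h
    exact ⟨b, h, idem_eq_some.2 ⟨rfl, b, one_mul b⟩⟩

theorem Idem.conj_mk_self [IsRightLCM S] (s : S) : Idem.conj s (Idem.mk s) = Idem.mk (1 : S) := by
  apply Subtype.ext
  change comp (lam s).symm (comp (idem s) (lam s)) = idem 1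
  apply pequiv_ext
  intro a b
  simp only [comp_eq_some, lam_symm_eq_some, lam_eq_some, idem_eq_some]
  constructor
  · rintro ⟨c, ⟨_, rfl, rfl, -⟩, h⟩
    exact ⟨mul_left_cancel h.symm, a, one_mul a⟩
  · rintro ⟨rfl, -⟩
    exact ⟨s * a, ⟨_, rfl, rfl, a, rfl⟩, rfl⟩

/-! ### The space of characters and the scaling condition -/

variable (S) in
/-- The space of nonzero semigroup homomorphisms `χ : E(S) → {0, 1}` with `χ(0) = 0`
(here `{0, 1}` is `Bool`, with multiplication `&&`). -/
def Character [IsRightLCM S] : Type u :=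
  {χ : Idem S → Bool // (∃ e, χ e = true) ∧ χ 0 = false ∧ ∀ e f, χ (e * f) = (χ e && χ f)}

/-- The topology of pointwise convergence. -/
instance [IsRightLCM S] : TopologicalSpace (Character S) :=
  inferInstanceAs (TopologicalSpace {χ : Idem S → Bool //
    (∃ e, χ e = true) ∧ χ 0 = false ∧ ∀ e f, χ (e * f) = (χ e && χ f)})

instance [IsRightLCM S] : MeasurableSpace (Character S) := borel _

instance [IsRightLCM S] : BorelSpace (Character S) := ⟨rfl⟩

/-- The character `λ_s · χ`, given by `(λ_s · χ)(e) = χ(λ_s⁻¹ e λ_s)`. -/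
def Character.act [IsRightLCM S] (s : S) (χ : Character S) : Character S :=
  ⟨fun e => χ.1 (Idem.conj s e), by
    obtain ⟨χ, ⟨e, he⟩, h0, hmul⟩ := χ
    refine ⟨⟨Idem.mk s, ?_⟩, ?_, fun e f => ?_⟩
    · have h := hmul (Idem.mk 1) e
      rw [Idem.mk_one_mul, he] at h
      change χ (Idem.conj s (Idem.mk s)) = true
      rw [Idem.conj_mk_self]
      simpa using h.symm
    · change χ (Idem.conj s 0) = false
      rw [Idem.conj_zero, h0]
    · change χ (Idem.conj s (e * f)) = _
      rw [Idem.conj_mul, hmul]⟩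

/-- `μ(λ_s · A) = N(s)^{-β} μ(A)` for all Borel sets `A` of characters and all `s ∈ S`. -/
def IsScaling [IsRightLCM S] (N : Scale S) (β : ℝ)
    (μ : MeasureTheory.Measure (Character S)) : Prop :=
  ∀ s : S, ∀ A : Set (Character S), MeasurableSet A →
    μ (Character.act s '' A) = ENNReal.ofReal (N s ^ (-β)) * μ A

end Semilattice

/-! ### The semigroup C*-algebra `C*(S)` -/

section CStar

variable (S : Type u) [Monoid S]

/-- A family of isometries in a unital C*-algebra `A` satisfying the defining relations
of `C*(S)`. -/
structure Rep (A : Type*) [CStarAlgebra A] where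
  toFun : S → A
  isometry (s : S) : star (toFun s) * toFun s = 1
  map_one : toFun 1 = 1
  map_mul (s t : S) : toFun s * toFun t = toFun (s * t)
  range_mul (s t r : S) (h : rightIdeal s ∩ rightIdeal t = rightIdeal r) :
    toFun s * star (toFun s) * (toFun t * star (toFun t)) = toFun r * star (toFun r)
  range_mul_eq_zero (s t : S) (h : rightIdeal s ∩ rightIdeal t = ∅) :
    toFun s * star (toFun s) * (toFun t * star (toFun t)) = 0

/-- All families of isometries satisfying the defining relations, in all nonzero unital C*-algebras
of the universe of `S`. -/
structure RepIndex where
  carrier : Type u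
  [cstar : CStarAlgebra carrier]
  [nontrivial : Nontrivial carrier]
  rep : Rep S carrier

attribute [instance] RepIndex.cstar RepIndex.nontrivial

/-- The C*-algebra of bounded elements of the product over all representations. -/
abbrev BigProduct : Type (u + 1) := lp (fun i : RepIndex S => i.carrier) ∞

instance : CStarAlgebra (BigProduct S) where

variable {S}

theorem Rep.norm_le {A : Type*} [CStarAlgebra A] [Nontrivial A] (v : Rep S A) (s : S) :
    ‖v.toFun s‖ ≤ 1 := by
  have h : ‖v.toFun s‖ * ‖v.toFun s‖ = 1 := by
    rw [← CStarRing.norm_star_mul_self, v.isometry, norm_one]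
  nlinarith [norm_nonneg (v.toFun s)]

/-- The element of the product whose coordinate at the representation `i` is the image of `s`
under `i`. -/
def bigGen (s : S) : BigProduct S :=
  ⟨fun i => i.rep.toFun s, memℓp_infty ⟨1, by
    rintro _ ⟨i, rfl⟩
    exact i.rep.norm_le s⟩⟩

variable (S)

/-- `C*(S)`: the C*-subalgebra generated by the elements `bigGen s` in the product over all
representations, i.e. the universal C*-algebra of the defining relations. -/
def cstarSub : StarSubalgebra ℂ (BigProduct S) :=
  (StarAlgebra.adjoin ℂ (Set.range (bigGen (S := S)))).topologicalClosure

/-- The semigroup C*-algebra `C*(S)`. -/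
abbrev SemigroupCStar : Type (u + 1) := cstarSub S

instance : IsClosed (cstarSub S : Set (BigProduct S)) :=
  StarSubalgebra.isClosed_topologicalClosure _

/-- The C*-algebra structure of `C*(S)`. -/
instance : CStarAlgebra (SemigroupCStar S) := StarSubalgebra.cstarAlgebra (cstarSub S)

variable {S}

theorem bigGen_mem (s : S) : bigGen s ∈ cstarSub S :=
  StarSubalgebra.le_topologicalClosure _ (StarAlgebra.subset_adjoin ℂ _ ⟨s, rfl⟩)

variable (S) in
/-- The canonical generating isometries `v_s` of `C*(S)`. -/
def gen : Rep S (SemigroupCStar S) where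
  toFun s := ⟨bigGen s, bigGen_mem s⟩
  isometry s := Subtype.ext (lp.ext (funext fun i => i.rep.isometry s))
  map_one := Subtype.ext (lp.ext (funext fun i => i.rep.map_one))
  map_mul s t := Subtype.ext (lp.ext (funext fun i => i.rep.map_mul s t))
  range_mul s t r h := Subtype.ext (lp.ext (funext fun i => i.rep.range_mul s t r h))
  range_mul_eq_zero s t h := Subtype.ext (lp.ext (funext fun i => i.rep.range_mul_eq_zero s t h))

theorem starAlgHom_continuous {A B : Type*} [CStarAlgebra A] [CStarAlgebra B]
    (π : A →⋆ₐ[ℂ] B) : Continuous π :=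
  AddMonoidHomClass.continuous_of_bound π 1 fun a => by
    rw [one_mul]; exact NonUnitalStarAlgHom.norm_apply_le π a

/-- The universal property of `C*(S)`. -/
theorem SemigroupCStar.existsUnique_lift {A : Type u} [CStarAlgebra A] (v : Rep S A) :
    ∃! π : SemigroupCStar S →⋆ₐ[ℂ] A, ∀ s, π ((gen S).toFun s) = v.toFun s := by
  refine existsUnique_of_exists_of_unique ?_ ?_
  · rcases subsingleton_or_nontrivial A with hA | hA
    · exact ⟨{ toFun := fun _ => 0
               map_one' := Subsingleton.elim _ _
               map_mul' := fun _ _ => Subsingleton.elim _ _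
               map_zero' := rfl
               map_add' := fun _ _ => Subsingleton.elim _ _
               commutes' := fun _ => Subsingleton.elim _ _
               map_star' := fun _ => Subsingleton.elim _ _ }, fun _ => Subsingleton.elim _ _⟩
    · exact ⟨{ toFun := fun f => f.1 ⟨A, v⟩
               map_one' := rfl
               map_mul' := fun _ _ => rfl
               map_zero' := rfl
               map_add' := fun _ _ => rfl
               commutes' := fun _ => rfl
               map_star' := fun _ => rfl }, fun _ => rfl⟩
  · intro π ρ hπ hρ
    refine StarAlgHom.ext_topologicalClosure (starAlgHom_continuous π)
      (starAlgHom_continuous ρ) ?_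
    refine StarAlgHom.ext_adjoin ?_
    rintro ⟨x, hx⟩ ⟨s, rfl⟩
    exact (hπ s).trans (hρ s).symm

/-! ### The dynamics -/

theorem Scale.pos (N : Scale S) (s : S) : 0 < N s := lt_of_lt_of_le one_pos (N.one_le s)

/-- The phase `N(s)^{it}`. -/
def Scale.phase (N : Scale S) (t : ℝ) (s : S) : ℂ := (N s : ℂ) ^ (Complex.I * t)

theorem Scale.phase_one (N : Scale S) (t : ℝ) : N.phase t 1 = 1 := by
  have h : N 1 = 1 := N.toMonoidHom.map_one
  simp [Scale.phase, h]

theorem Scale.phase_mul (N : Scale S) (t : ℝ) (r s : S) :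
    N.phase t (r * s) = N.phase t r * N.phase t s := by
  have h : N (r * s) = N r * N s := N.toMonoidHom.map_mul r s
  rw [Scale.phase, h, Complex.ofReal_mul,
    Complex.mul_cpow_ofReal_nonneg (N.pos r).le (N.pos s).le]
  rfl

theorem Scale.star_phase_mul (N : Scale S) (t : ℝ) (s : S) :
    star (N.phase t s) * N.phase t s = 1 := by
  have h : ‖N.phase t s‖ = 1 := by
    rw [Scale.phase, Complex.norm_cpow_eq_rpow_re_of_pos (N.pos s)]
    simp
  rw [Complex.star_def, Complex.conj_mul', h]
  simp

/-- The representation `s ↦ N(s)^{it} v_s` obtained from a representation `v`. -/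
def Rep.twist {A : Type*} [CStarAlgebra A] (N : Scale S) (t : ℝ) (v : Rep S A) : Rep S A :=
  have key (s : S) : N.phase t s • v.toFun s * star (N.phase t s • v.toFun s) =
      v.toFun s * star (v.toFun s) := by
    rw [star_smul, smul_mul_smul_comm, mul_comm, N.star_phase_mul, one_smul]
  { toFun := fun s => N.phase t s • v.toFun s
    isometry := fun s => by
      rw [star_smul, smul_mul_smul_comm, N.star_phase_mul, one_smul, v.isometry]
    map_one := by rw [N.phase_one, one_smul, v.map_one]
    map_mul := fun r s => by rw [smul_mul_smul_comm, N.phase_mul, v.map_mul]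
    range_mul := fun s t r h => by rw [key, key, key, v.range_mul s t r h]
    range_mul_eq_zero := fun s t h => by rw [key, key, v.range_mul_eq_zero s t h] }

/-- The twist, as a map on the index set of all representations. -/
def RepIndex.twist (N : Scale S) (t : ℝ) (i : RepIndex S) : RepIndex S :=
  ⟨i.carrier, i.rep.twist N t⟩

/-- The endomorphism `f ↦ (i ↦ f (twist i))` of the product of all representations. -/
def bigDynamics (N : Scale S) (t : ℝ) : BigProduct S →⋆ₐ[ℂ] BigProduct S where
  toFun f := ⟨fun i => f (i.twist N t), memℓp_infty ⟨‖f‖, by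
    rintro _ ⟨i, rfl⟩
    exact lp.norm_apply_le_norm ENNReal.top_ne_zero f (i.twist N t)⟩⟩
  map_one' := rfl
  map_mul' _ _ := rfl
  map_zero' := rfl
  map_add' _ _ := rfl
  commutes' _ := rfl
  map_star' _ := rfl

theorem bigDynamics_gen (N : Scale S) (t : ℝ) (s : S) :
    bigDynamics N t (bigGen s) = N.phase t s • bigGen s := rfl

theorem bigDynamics_continuous (N : Scale S) (t : ℝ) : Continuous (bigDynamics N t) :=
  starAlgHom_continuous (bigDynamics N t)

theorem bigDynamics_mem (N : Scale S) (t : ℝ) (a : SemigroupCStar S) :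
    bigDynamics N t a.1 ∈ cstarSub S := by
  have h1 : StarAlgebra.adjoin ℂ (Set.range (bigGen (S := S))) ≤
      (cstarSub S).comap (bigDynamics N t) := by
    refine StarAlgebra.adjoin_le ?_
    rintro _ ⟨s, rfl⟩
    change bigDynamics N t (bigGen s) ∈ cstarSub S
    rw [bigDynamics_gen]
    exact (cstarSub S).smul_mem (bigGen_mem s) _
  have h2 : IsClosed ((cstarSub S).comap (bigDynamics N t) : Set (BigProduct S)) :=
    (StarSubalgebra.isClosed_topologicalClosure _).preimage (bigDynamics_continuous N t)
  exact StarSubalgebra.topologicalClosure_minimal h1 h2 a.2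

/-- The dynamics `σ^N` on `C*(S)`, determined by `σ^N_t(v_s) = N(s)^{it} v_s`. -/
def dynamics (N : Scale S) (t : ℝ) : SemigroupCStar S →⋆ₐ[ℂ] SemigroupCStar S :=
  ((bigDynamics N t).comp (cstarSub S).subtype).codRestrict (cstarSub S) (bigDynamics_mem N t)

theorem dynamics_gen (N : Scale S) (t : ℝ) (s : S) :
    dynamics N t ((gen S).toFun s) = (N s : ℂ) ^ (Complex.I * t) • (gen S).toFun s := rfl

end CStar

/-! ### KMS states -/

section KMS

variable {A : Type*} [CStarAlgebra A]

/-- A state: a bounded linear functional which is positive and unital. -/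
def IsState (φ : A →L[ℂ] ℂ) : Prop := φ 1 = 1 ∧ ∀ a, 0 ≤ φ (star a * a)

/-- `F` is the entire function `z ↦ σ_z(a)`, i.e. the (necessarily unique) entire extension
of `t ↦ σ_t(a)`. -/
def IsEntireExtension (σ : ℝ → A →⋆ₐ[ℂ] A) (a : A) (F : ℂ → A) : Prop :=
  Differentiable ℂ F ∧ ∀ t : ℝ, F t = σ t a

/-- `φ` is a `σ`-KMS state at inverse temperature `β`: there is a dense `σ`-invariant subspace
of `σ`-analytic elements such that `φ(ab) = φ(b σ_{iβ}(a))` for all `a`, `b` in it. -/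
def IsKMSState (σ : ℝ → A →⋆ₐ[ℂ] A) (β : ℝ) (φ : A →L[ℂ] ℂ) : Prop :=
  IsState φ ∧ ∃ D : Submodule ℂ A, Dense (D : Set A) ∧ (∀ t, ∀ a ∈ D, σ t a ∈ D) ∧
    ∀ a ∈ D, ∃ F : ℂ → A, IsEntireExtension σ a F ∧
      ∀ b ∈ D, φ (a * b) = φ (b * F (Complex.I * β))

end KMS

end RightLCM

end

noncomputable section

namespace RightLCM

universe u

/-! ### Weights -/

section Weights

variable {S : Type u} [Monoid S]

/-! Both hypotheses give the idempotent `e_s` the mass `N(s)^{-β}`: in (a) as the measure of `{χ |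
χ(e_s) = 1}`, the image of the whole space under `λ_s` (`IsScaling.measure_support`), in (b) as
`φ(v_s v_s*)` (`IsKMSState.apply_range_projection`). Mass is at most `1`, so nontriviality of `N`
forces `β ≥ 0`. For `t ∈ ker N` the mass of `e_t` is `1`, so cutting `e_s` by `e_t` loses nothing:
`e_s e_t` still has mass `N(s)^{-β} > 0`. Hence `sS ∩ tS` is nonempty, equal to some `rS`, and
`N(r)^{-β} = N(s)^{-β}`. If `β ≠ 0` this gives `N(r) = N(s)`, and `r = sk` has `k ∈ ker N`.

The analytic work is in (b): the KMS identity is given only on a dense subspace that may miss `v_s`.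
`IsKMSState.apply_mul_of_eigenvector` transfers it to eigenvectors of the dynamics by approximation
and a contour argument on a strip. -/

theorem mem_rightIdeal_self (s : S) : s ∈ rightIdeal s := ⟨1, mul_one s⟩

theorem Scale.map_mul (N : Scale S) (s t : S) : N (s * t) = N s * N t :=
  N.toMonoidHom.map_mul s t

/-- The common conclusion, from the numerical properties of the weights `N(s)^{-β}`. -/
theorem Scale.eq_zero_or_admissible (N : Scale S) (hN : N.Nontrivial) {β : ℝ}
    (hle : ∀ s, N s ^ (-β) ≤ 1)
    (hinter : ∀ s, ∀ t ∈ N.ker, ∃ r, rightIdeal s ∩ rightIdeal t = rightIdeal r ∧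
      N r ^ (-β) = N s ^ (-β)) :
    β = 0 ∨ (0 < β ∧ N.Admissible) := by
  obtain ⟨s₀, hs₀⟩ := hN
  have h1 : 1 < N s₀ := lt_of_le_of_ne (N.one_le s₀) (Ne.symm hs₀)
  have hβ : 0 ≤ β := by
    by_contra! h
    exact absurd (hle s₀) (not_le.2 (Real.one_lt_rpow h1 (by linarith)))
  rcases hβ.eq_or_lt with h | h
  · exact Or.inl h.symm
  refine Or.inr ⟨h, fun s t ht => ?_⟩
  obtain ⟨r, hr, hrs⟩ := hinter s t ht
  have hrs' : N r = N s :=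
    -- Only here is `β ≠ 0` needed: the weight determines `N`.
    (Real.rpow_left_inj (N.pos r).le (N.pos s).le (neg_ne_zero.2 h.ne')).1 hrs
  have hmem : r ∈ rightIdeal s ∩ rightIdeal t := hr ▸ mem_rightIdeal_self r
  obtain ⟨k, rfl⟩ := hmem.1
  refine ⟨s * k, ⟨k, ?_, rfl⟩, hr⟩
  rw [N.map_mul] at hrs'
  exact mul_left_cancel₀ (N.pos s).ne' (hrs'.trans (mul_one _).symm)

theorem Scale.rpow_eq_one_of_mem_ker (N : Scale S) {t : S} (ht : t ∈ N.ker) (β : ℝ) :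
    N t ^ β = 1 := by
  rw [show N t = 1 from ht, Real.one_rpow]

end Weights

/-! ### Scaling measures -/

section Measure

variable {S : Type u} [Monoid S] [IsLeftCancelMul S]

theorem comp_lam_idem_symm (s t : S) :
    comp (lam s) (comp (idem t) (lam s).symm) = idem (s * t) := by
  apply pequiv_ext
  intro a b
  simp only [comp_eq_some, lam_symm_eq_some, lam_eq_some, idem_eq_some]
  constructor
  · rintro ⟨_, ⟨c, rfl, rfl, d, rfl⟩, rfl⟩
    exact ⟨rfl, d, mul_assoc s t d⟩
  · rintro ⟨rfl, d, rfl⟩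
    exact ⟨t * d, ⟨t * d, (mul_assoc s t d).symm, rfl, d, rfl⟩, (mul_assoc s t d).symm⟩

/-- The map `e ↦ λ_s e λ_s⁻¹` on `E(S)`. -/
def Idem.push (s : S) (e : Idem S) : Idem S :=
  ⟨comp (lam s) (comp e.1 (lam s).symm), by
    rcases e with ⟨e, ⟨t, rfl⟩ | rfl⟩
    · exact Or.inl ⟨s * t, comp_lam_idem_symm s t⟩
    · right
      simp [comp]⟩

theorem Idem.push_mk (s t : S) : Idem.push s (Idem.mk t) = Idem.mk (s * t) :=
  Subtype.ext (comp_lam_idem_symm s t)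

theorem Idem.push_zero (s : S) : Idem.push s (0 : Idem S) = 0 := by
  apply Subtype.ext
  change comp (lam s) (comp ⊥ (lam s).symm) = ⊥
  simp [comp]

variable [IsRightLCM S]

theorem Idem.push_mul (s : S) (e f : Idem S) :
    Idem.push s (e * f) = Idem.push s e * Idem.push s f := by
  apply Subtype.ext
  change comp (lam s) (comp (comp e.1 f.1) (lam s).symm) =
    comp (comp (lam s) (comp e.1 (lam s).symm)) (comp (lam s) (comp f.1 (lam s).symm))
  apply pequiv_ext
  intro a b
  simp only [comp_eq_some, lam_symm_eq_some, lam_eq_some]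
  constructor
  · rintro ⟨c, ⟨d, rfl, d', h1, h2⟩, rfl⟩
    exact ⟨s * d', ⟨d', ⟨d, rfl, h1⟩, rfl⟩, c, ⟨d', rfl, h2⟩, rfl⟩
  · rintro ⟨_, ⟨d', ⟨d, rfl, h1⟩, rfl⟩, c, ⟨d'', h2, h3⟩, rfl⟩
    obtain rfl := mul_left_cancel h2
    exact ⟨c, ⟨d, rfl, d'', h1, h3⟩, rfl⟩

/-- Elements of `E(S)` are partial identities, so `λ_s λ_s⁻¹ e λ_s λ_s⁻¹ = e_s e e_s` collapses to
`e_s e`. This makes `push` invert the action on characters with `χ(e_s) = 1`. -/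
theorem Idem.push_conj (s : S) (e : Idem S) :
    Idem.push s (Idem.conj s e) = Idem.mk s * e := by
  have diag : ∀ a b : S, e.1 a = some b → a = b := by
    rcases e with ⟨e, ⟨t, rfl⟩ | rfl⟩ <;> intro a b h
    · exact (idem_eq_some.1 h).1
    · simp at h
  apply Subtype.ext
  change comp (lam s) (comp (comp (lam s).symm (comp e.1 (lam s))) (lam s).symm) =
    comp (idem s) e.1
  apply pequiv_ext
  intro a b
  simp only [comp_eq_some, lam_symm_eq_some, lam_eq_some, idem_eq_some]
  constructor
  · rintro ⟨_, ⟨d, rfl, _, ⟨_, rfl, h1⟩, rfl⟩, rfl⟩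
    exact ⟨_, h1, rfl, _, rfl⟩
  · rintro ⟨c, h1, rfl, d, rfl⟩
    obtain rfl := diag _ _ h1
    exact ⟨d, ⟨d, rfl, _, ⟨_, rfl, h1⟩, rfl⟩, rfl⟩

theorem Idem.mk_mul_mk_of_inter_eq {s t r : S}
    (h : rightIdeal s ∩ rightIdeal t = rightIdeal r) :
    Idem.mk s * Idem.mk t = Idem.mk r := by
  apply Subtype.ext
  change comp (idem s) (idem t) = idem r
  apply pequiv_ext
  intro a b
  rw [comp_eq_some, idem_eq_some, ← h]
  simp only [idem_eq_some, Set.mem_inter_iff]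
  constructor
  · rintro ⟨c, ⟨rfl, h1⟩, rfl, h2⟩
    exact ⟨rfl, h2, h1⟩
  · rintro ⟨rfl, h1, h2⟩
    exact ⟨a, ⟨rfl, h2⟩, rfl, h1⟩

theorem Idem.mk_mul_mk_of_inter_empty {s t : S} (h : rightIdeal s ∩ rightIdeal t = ∅) :
    Idem.mk s * Idem.mk t = 0 := by
  apply Subtype.ext
  change comp (idem s) (idem t) = ⊥
  apply pequiv_ext
  intro a b
  simp only [comp_eq_some, idem_eq_some, PEquiv.bot_apply, reduceCtorEq, iff_false]
  rintro ⟨c, ⟨rfl, h1⟩, rfl, h2⟩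
  exact Set.notMem_empty a (h ▸ ⟨h2, h1⟩)

/-! ### Supports of the idempotents in the character space -/

theorem Character.apply_mk_one (χ : Character S) : χ.1 (Idem.mk 1) = true := by
  obtain ⟨e, he⟩ := χ.2.1
  have h := χ.2.2.2 (Idem.mk 1) e
  rw [Idem.mk_one_mul, he] at h
  simpa using h.symm

/-- The set of characters not vanishing at `e_s`. -/
def Character.support (s : S) : Set (Character S) := {χ | χ.1 (Idem.mk s) = true}

/-- A preimage of `χ` is `e ↦ χ(λ_s e λ_s⁻¹)`; it is nonzero, and acting by `λ_s` recovers `χ`,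
because `χ(e_s) = 1`. -/
theorem Character.range_act (s : S) :
    Character.act s '' (Set.univ : Set (Character S)) = Character.support s := by
  ext χ
  constructor
  · rintro ⟨χ, -, rfl⟩
    change χ.1 (Idem.conj s (Idem.mk s)) = true
    rw [Idem.conj_mk_self, χ.apply_mk_one]
  · intro hχ
    have hχ' : χ.1 (Idem.mk s) = true := hχ
    refine ⟨⟨fun e => χ.1 (Idem.push s e), ⟨Idem.mk 1, ?_⟩, ?_, fun e f => ?_⟩, trivial, ?_⟩
    · change χ.1 (Idem.push s (Idem.mk 1)) = true
      rw [Idem.push_mk, mul_one, hχ']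
    · change χ.1 (Idem.push s 0) = false
      rw [Idem.push_zero, χ.2.2.1]
    · change χ.1 (Idem.push s (e * f)) = _
      rw [Idem.push_mul, χ.2.2.2]
    · refine Subtype.ext (funext fun e => ?_)
      change χ.1 (Idem.push s (Idem.conj s e)) = χ.1 e
      rw [Idem.push_conj, χ.2.2.2, hχ', Bool.true_and]

theorem Character.measurableSet_support (s : S) :
    MeasurableSet (Character.support s) := by
  have hc : Continuous fun χ : Character S => χ.1 (Idem.mk s) :=
    (continuous_apply (Idem.mk s)).comp continuous_subtype_val
  exact ((isOpen_discrete {true}).preimage hc).measurableSet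

theorem Character.support_inter_of_inter_eq {s t r : S}
    (h : rightIdeal s ∩ rightIdeal t = rightIdeal r) :
    Character.support s ∩ Character.support t = Character.support r := by
  ext χ
  have h1 := χ.2.2.2 (Idem.mk s) (Idem.mk t)
  rw [Idem.mk_mul_mk_of_inter_eq h] at h1
  simp [Character.support, h1]

theorem Character.support_inter_of_inter_empty {s t : S}
    (h : rightIdeal s ∩ rightIdeal t = ∅) :
    Character.support s ∩ Character.support t = ∅ := by
  ext χ
  have h1 := χ.2.2.2 (Idem.mk s) (Idem.mk t)
  rw [Idem.mk_mul_mk_of_inter_empty h, χ.2.2.1] at h1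
  simpa [Character.support] using h1

theorem IsScaling.measure_support {N : Scale S} {β : ℝ} {μ : MeasureTheory.Measure (Character S)}
    [MeasureTheory.IsProbabilityMeasure μ] (hμ : IsScaling N β μ) (s : S) :
    μ (Character.support s) = ENNReal.ofReal (N s ^ (-β)) := by
  rw [← Character.range_act, hμ s _ MeasurableSet.univ, MeasureTheory.measure_univ, mul_one]

theorem IsScaling.eq_zero_or_admissible {N : Scale S} (hN : N.Nontrivial) {β : ℝ}
    {μ : MeasureTheory.Measure (Character S)} [MeasureTheory.IsProbabilityMeasure μ]
    (hμ : IsScaling N β μ) : β = 0 ∨ (0 < β ∧ N.Admissible) := by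
  have hpos (s : S) : 0 < N s ^ (-β) := Real.rpow_pos_of_pos (N.pos s) _
  refine N.eq_zero_or_admissible hN (fun s => ?_) fun s t ht => ?_
  · rw [← ENNReal.ofReal_le_one, ← hμ.measure_support]
    exact MeasureTheory.prob_le_one
  · have hst : μ (Character.support s ∩ Character.support t) =
        ENNReal.ofReal (N s ^ (-β)) := by
      rw [← hμ.measure_support]
      -- The support of `e_t` has full measure, since `N(t) = 1`.
      refine MeasureTheory.measure_inter_conull ?_
      rw [MeasureTheory.prob_compl_eq_zero_iff (Character.measurableSet_support t),
        hμ.measure_support, N.rpow_eq_one_of_mem_ker ht, ENNReal.ofReal_one]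
    rcases IsRightLCM.inter s t with h | ⟨r, hr⟩
    · rw [Character.support_inter_of_inter_empty h, MeasureTheory.measure_empty] at hst
      exact absurd (ENNReal.ofReal_eq_zero.1 hst.symm) (not_le.2 (hpos s))
    · refine ⟨r, hr, ?_⟩
      rwa [Character.support_inter_of_inter_eq hr, hμ.measure_support,
        ENNReal.ofReal_eq_ofReal_iff (hpos r).le (hpos s).le] at hst

end Measure

/-! ### KMS states -/

section KMSStates

variable {A : Type*} [CStarAlgebra A]

theorem IsState.nonneg_of_isStarProjection {φ : A →L[ℂ] ℂ} (hφ : IsState φ) {p : A}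
    (hp : IsStarProjection p) : 0 ≤ φ p := by
  have h := hφ.2 p
  rwa [hp.isSelfAdjoint.star_eq, hp.isIdempotentElem.eq] at h

/-- The projections `p(1 - q)` and `(1 - p)(1 - q)` add up to `1 - q`, on which `φ` vanishes. Both
values are nonnegative, so both are zero. -/
theorem IsState.apply_mul_eq_of_apply_eq_one {φ : A →L[ℂ] ℂ} (hφ : IsState φ) {p q : A}
    (hp : IsStarProjection p) (hq : IsStarProjection q) (hpq : Commute p q) (h : φ q = 1) :
    φ (p * q) = φ p := by
  have h1 := hφ.nonneg_of_isStarProjection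
    (hp.mul hq.one_sub ((Commute.one_right p).sub_right hpq))
  have h2 := hφ.nonneg_of_isStarProjection (hp.one_sub.mul hq.one_sub
    ((Commute.one_left _).sub_left ((Commute.one_right p).sub_right hpq)))
  have e1 : φ (p * (1 - q)) = φ p - φ (p * q) := by rw [mul_sub, mul_one, map_sub]
  have e2 : φ ((1 - p) * (1 - q)) = -φ (p * (1 - q)) := by
    rw [sub_mul, one_mul, map_sub, map_sub, hφ.1, h, sub_self, zero_sub]
  rw [e2] at h2
  have h3 : φ (p * (1 - q)) = 0 := le_antisymm (neg_nonneg.1 h2) h1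
  rw [e1, sub_eq_zero] at h3
  exact h3.symm

/-- Entire functions agreeing on the real line are equal. -/
theorem eq_of_forall_real_eq {E : Type*} [NormedAddCommGroup E] [NormedSpace ℂ E]
    [CompleteSpace E] {F G : ℂ → E} (hF : Differentiable ℂ F) (hG : Differentiable ℂ G)
    (h : ∀ t : ℝ, F t = G t) : F = G := by
  refine AnalyticOnNhd.eq_of_frequently_eq (z₀ := 0) (fun z _ => hF.analyticAt z)
    (fun z _ => hG.analyticAt z) ?_
  -- The identity theorem needs agreement at points accumulating at `0`; nonzero reals suffice.
  have h1 : Filter.Tendsto (fun t : ℝ => (t : ℂ)) (nhdsWithin 0 {0}ᶜ) (nhdsWithin 0 {0}ᶜ) := by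
    refine tendsto_nhdsWithin_of_tendsto_nhds_of_eventually_within _ ?_ ?_
    · exact (Complex.continuous_ofReal.tendsto' 0 0 Complex.ofReal_zero).mono_left
        nhdsWithin_le_nhds
    · filter_upwards [self_mem_nhdsWithin] with t ht
      simpa using ht
  exact h1.frequently (Filter.Frequently.of_forall h)

/-- A bounded holomorphic function on a horizontal strip has the same mean values along the two
boundary lines, so these cannot be close to different constants. -/
theorem norm_sub_le_of_bounded_on_strip {L : ℂ → ℂ} (hL : Differentiable ℂ L) {β M δ η : ℝ}
    {c d : ℂ} (hM : ∀ x : ℝ, ∀ y ∈ Set.uIcc 0 β, ‖L (x + y * Complex.I)‖ ≤ M)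
    (h0 : ∀ x : ℝ, ‖L x - c‖ ≤ δ) (h1 : ∀ x : ℝ, ‖L (x + β * Complex.I) - d‖ ≤ η) :
    ‖c - d‖ ≤ δ + η := by
  -- Cauchy's theorem on the rectangle with corners `0` and `T + iβ`: the two vertical sides cost at
  -- most `2M|β|` independently of `T`, so the estimate follows for large `T`.
  have key : ∀ T : ℝ, 0 < T → T * ‖c - d‖ ≤ T * (δ + η) + 2 * M * |β| := by
    intro T hT
    have hrect := Complex.integral_boundary_rect_eq_zero_of_differentiableOn L 0
      (T + β * Complex.I) hL.differentiableOn
    simp only [Complex.zero_re, Complex.zero_im, Complex.add_re, Complex.add_im,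
      Complex.ofReal_re, Complex.ofReal_im, Complex.mul_re, Complex.mul_im, Complex.I_re,
      Complex.I_im, mul_zero, mul_one, zero_add, add_zero, sub_zero, zero_mul,
      Complex.ofReal_zero] at hrect
    have hc0 : Continuous fun x : ℝ => L x := hL.continuous.comp Complex.continuous_ofReal
    have hc1 : Continuous fun x : ℝ => L (x + β * Complex.I) :=
      hL.continuous.comp (by fun_prop)
    have i0 : ‖∫ x in (0 : ℝ)..T, (L x - c)‖ ≤ δ * |T - 0| :=
      intervalIntegral.norm_integral_le_of_norm_le_const fun x _ => h0 x
    have i1 : ‖∫ x in (0 : ℝ)..T, (L (x + β * Complex.I) - d)‖ ≤ η * |T - 0| :=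
      intervalIntegral.norm_integral_le_of_norm_le_const fun x _ => h1 x
    have i2 : ‖∫ y in (0 : ℝ)..β, L (T + y * Complex.I)‖ ≤ M * |β - 0| :=
      intervalIntegral.norm_integral_le_of_norm_le_const fun y hy =>
        hM T y (Set.uIoc_subset_uIcc hy)
    have i3 : ‖∫ y in (0 : ℝ)..β, L (y * Complex.I)‖ ≤ M * |β - 0| :=
      intervalIntegral.norm_integral_le_of_norm_le_const fun y hy => by
        simpa using hM 0 y (Set.uIoc_subset_uIcc hy)
    rw [intervalIntegral.integral_sub (hc0.intervalIntegrable _ _)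
      intervalIntegrable_const, intervalIntegral.integral_const] at i0
    rw [intervalIntegral.integral_sub (hc1.intervalIntegrable _ _)
      intervalIntegrable_const, intervalIntegral.integral_const] at i1
    rw [sub_zero, abs_of_pos hT] at i0 i1
    rw [sub_zero] at i2 i3
    set a0 := ∫ x in (0 : ℝ)..T, L x
    set a1 := ∫ x in (0 : ℝ)..T, L (x + β * Complex.I)
    set a2 := ∫ y in (0 : ℝ)..β, L (T + y * Complex.I)
    set a3 := ∫ y in (0 : ℝ)..β, L (y * Complex.I)
    have hid : (T : ℂ) * (c - d) = -(a0 - (T - 0) • c) + (a1 - (T - 0) • d)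
        - Complex.I * a2 + Complex.I * a3 := by
      simp only [smul_eq_mul, Complex.real_smul, sub_zero] at hrect ⊢
      linear_combination hrect
    have hn : T * ‖c - d‖ = ‖(T : ℂ) * (c - d)‖ := by
      rw [norm_mul, Complex.norm_real, Real.norm_of_nonneg hT.le]
    have n2 : ‖Complex.I * a2‖ = ‖a2‖ := by rw [norm_mul, Complex.norm_I, one_mul]
    have n3 : ‖Complex.I * a3‖ = ‖a3‖ := by rw [norm_mul, Complex.norm_I, one_mul]
    rw [hn, hid]
    refine (norm_add_le _ _).trans ?_
    refine (add_le_add_left ((norm_sub_le _ _).trans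
      (add_le_add_left (norm_add_le _ _) _)) _).trans ?_
    rw [norm_neg, n2, n3]
    simp only [sub_zero] at i0 i1 ⊢
    linarith
  by_contra! hlt
  have hg : 0 < ‖c - d‖ - (δ + η) := sub_pos.2 hlt
  obtain ⟨n, hn⟩ := exists_nat_gt (2 * M * |β| / (‖c - d‖ - (δ + η)))
  have h2 := key (n + 1) (by positivity)
  rw [div_lt_iff₀ hg] at hn
  nlinarith

/-! ### The KMS condition for eigenvectors of the dynamics -/

variable {σ : ℝ → A →⋆ₐ[ℂ] A}

/-- Both sides are entire in `z` and agree on the real line by the group law. As `σ x` is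
contractive, a bound for `F` on a vertical segment spreads to the whole strip. -/
theorem IsEntireExtension.add_real {a : A} {F : ℂ → A} (hF : IsEntireExtension σ a F)
    (hσ : ∀ s t a, σ s (σ t a) = σ (s + t) a) (x : ℝ) (z : ℂ) :
    F (x + z) = σ x (F z) := by
  have h := eq_of_forall_real_eq (F := fun z => F (x + z)) (G := fun z => σ x (F z))
    (hF.1.comp (by fun_prop))
    ((ContinuousLinearMap.mk (σ x : A →ₗ[ℂ] A) (starAlgHom_continuous (σ x))).differentiable.comp
      hF.1) fun t => by
      rw [← Complex.ofReal_add, hF.2, hF.2, hσ]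
  exact congrFun h z

/-- An eigenvector `v` of the dynamics satisfies the KMS condition against every `b`. -/
theorem IsKMSState.apply_mul_of_eigenvector {φ : A →L[ℂ] ℂ} {β : ℝ} (hφ : IsKMSState σ β φ)
    (hσ : ∀ s t a, σ s (σ t a) = σ (s + t) a) {v : A} {h : ℝ}
    (hv : ∀ t : ℝ, σ t v = Complex.exp (Complex.I * t * h) • v) (b : A) :
    φ (v * b) = Real.exp (-(β * h)) * φ (b * v) := by
  obtain ⟨-, D, hD, hDσ, hKMS⟩ := hφ
  have hexp (t : ℝ) : ‖Complex.exp (-(Complex.I * t * h))‖ = 1 := by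
    rw [Complex.norm_exp]; simp
  have key : ∀ ε : ℝ, 0 < ε →
      ‖φ (b * v) - Real.exp (β * h) * φ (v * b)‖ ≤
        ‖φ‖ * ‖b‖ * ε + Real.exp (β * h) * (‖φ‖ * ‖b‖ * ε) := by
    intro ε hε
    -- The eigenvector `v` need not lie in `D`, so it is replaced by some `a ∈ D` within `ε`.
    obtain ⟨a, ha, hav⟩ := Metric.dense_iff.1 hD v ε hε
    rw [Metric.mem_ball, dist_eq_norm] at ha
    obtain ⟨F, hF, -⟩ := hKMS a hav
    have hclose (t : ℝ) :
        ‖Complex.exp (-(Complex.I * t * h)) • σ t a - v‖ ≤ ε := by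
      have : Complex.exp (-(Complex.I * t * h)) • σ t a - v =
          Complex.exp (-(Complex.I * t * h)) • σ t (a - v) := by
        rw [map_sub, smul_sub, hv, smul_smul, ← Complex.exp_add, neg_add_cancel,
          Complex.exp_zero, one_smul]
      rw [this, norm_smul, hexp, one_mul]
      exact (NonUnitalStarAlgHom.norm_apply_le (σ t) _).trans ha.le
    -- The KMS identity for `σ t a`, whose entire extension is the translate of `F`; it passes from
    -- `D` to arbitrary `b` by density and continuity.
    have hline (t : ℝ) : φ (b * F (t + β * Complex.I)) = φ (σ t a * b) := by
      obtain ⟨F', hF', hK⟩ := hKMS (σ t a) (hDσ t a hav)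
      have hFF' : F' = fun z => F (z + t) :=
        eq_of_forall_real_eq hF'.1 (hF.1.comp (by fun_prop)) fun s => by
          rw [← Complex.ofReal_add, hF.2, hF'.2, hσ]
      have hall := hD.induction (P := fun b => φ (σ t a * b) = φ (b * F' (Complex.I * β)))
        (fun b hb => hK b hb) (isClosed_eq (by fun_prop) (by fun_prop)) b
      rw [hall, hFF']
      congr 3
      ring
    obtain ⟨K, hK⟩ := (isCompact_uIcc (a := (0 : ℝ)) (b := β)).exists_bound_of_continuousOn
      (f := fun y : ℝ => F (y * Complex.I)) (hF.1.continuous.comp (by fun_prop)).continuousOn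
    obtain ⟨K', hK'⟩ := (isCompact_uIcc (a := (0 : ℝ)) (b := β)).exists_bound_of_continuousOn
      (f := fun y : ℝ => Complex.exp (y * h)) (by fun_prop)
    -- The factor `e^{-izh}` undoes the rotation of `v`. Thus `L` stays near `φ(bv)` on the real
    -- line and, by `hline`, near `e^{βh} φ(vb)` on the line of height `β`, with errors proportional
    -- to `ε`.
    refine norm_sub_le_of_bounded_on_strip
      (L := fun z => Complex.exp (-(Complex.I * z * h)) * φ (b * F z)) (β := β)
      (M := K' * (‖φ‖ * (‖b‖ * K))) ?_ ?_ ?_ ?_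
    · have := hF.1
      have h2 : Differentiable ℂ fun z => φ (b * F z) :=
        φ.differentiable.comp ((differentiable_const b).mul this)
      exact Differentiable.mul (by fun_prop) h2
    · intro x y hy
      have e1 : ‖Complex.exp (-(Complex.I * (x + y * Complex.I) * h))‖ ≤ K' := by
        refine le_of_eq_of_le ?_ (hK' y hy)
        rw [Complex.norm_exp, Complex.norm_exp]
        simp
      have e2 : ‖F (x + y * Complex.I)‖ ≤ K := by
        rw [hF.add_real hσ]
        exact (NonUnitalStarAlgHom.norm_apply_le (σ x) _).trans (hK y hy)
      rw [norm_mul]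
      refine mul_le_mul e1 ?_ (norm_nonneg _) ((norm_nonneg _).trans e1)
      refine (φ.le_opNorm _).trans (mul_le_mul_of_nonneg_left ?_ (norm_nonneg _))
      exact (norm_mul_le _ _).trans (mul_le_mul_of_nonneg_left e2 (norm_nonneg _))
    · intro t
      have : Complex.exp (-(Complex.I * t * h)) * φ (b * F t) - φ (b * v) =
          φ (b * (Complex.exp (-(Complex.I * t * h)) • σ t a - v)) := by
        rw [hF.2, mul_sub, map_sub, mul_smul_comm, map_smul, smul_eq_mul]
      rw [this, mul_assoc ‖φ‖]
      refine (φ.le_opNorm _).trans (mul_le_mul_of_nonneg_left ?_ (norm_nonneg _))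
      exact (norm_mul_le _ _).trans (mul_le_mul_of_nonneg_left (hclose t) (norm_nonneg _))
    · intro t
      have : Complex.exp (-(Complex.I * (t + β * Complex.I) * h)) *
            φ (b * F (t + β * Complex.I)) - Real.exp (β * h) * φ (v * b) =
          Real.exp (β * h) * φ ((Complex.exp (-(Complex.I * t * h)) • σ t a - v) * b) := by
        have e : Complex.exp (-(Complex.I * (t + β * Complex.I) * h)) =
            Real.exp (β * h) * Complex.exp (-(Complex.I * t * h)) := by
          rw [Complex.ofReal_exp, ← Complex.exp_add]
          congr 1
          push_cast
          linear_combination (-(β : ℂ) * h) * Complex.I_mul_I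
        rw [hline, e, sub_mul, map_sub, smul_mul_assoc, map_smul, smul_eq_mul]
        ring
      rw [this, norm_mul, Complex.norm_real, Real.norm_of_nonneg (Real.exp_pos _).le]
      refine mul_le_mul_of_nonneg_left ?_ (Real.exp_pos _).le
      rw [mul_assoc ‖φ‖]
      refine (φ.le_opNorm _).trans (mul_le_mul_of_nonneg_left ?_ (norm_nonneg _))
      rw [mul_comm ‖b‖]
      exact (norm_mul_le _ _).trans (mul_le_mul_of_nonneg_right (hclose t) (norm_nonneg _))
  have hzero : ‖φ (b * v) - Real.exp (β * h) * φ (v * b)‖ ≤ 0 := by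
    have hlim : Filter.Tendsto (fun ε : ℝ =>
        ‖φ‖ * ‖b‖ * ε + Real.exp (β * h) * (‖φ‖ * ‖b‖ * ε)) (nhdsWithin 0 (Set.Ioi 0))
        (nhds 0) := by
      refine Filter.Tendsto.mono_left (Continuous.tendsto' (by fun_prop) 0 0 (by simp))
        nhdsWithin_le_nhds
    exact ge_of_tendsto hlim (by filter_upwards [self_mem_nhdsWithin] with ε hε using key ε hε)
  have h1 := sub_eq_zero.1 (norm_le_zero_iff.1 hzero)
  rw [h1, ← mul_assoc, ← Complex.ofReal_mul, ← Real.exp_add, neg_add_cancel, Real.exp_zero,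
    Complex.ofReal_one, one_mul]

end KMSStates

/-! ### KMS states on `C*(S)` -/

section SemigroupKMS

variable {S : Type u} [Monoid S]

theorem Scale.phase_eq_exp (N : Scale S) (t : ℝ) (s : S) :
    N.phase t s = Complex.exp (Complex.I * t * Real.log (N s)) := by
  rw [Scale.phase, Complex.cpow_def_of_ne_zero (Complex.ofReal_ne_zero.2 (N.pos s).ne'),
    ← Complex.ofReal_log (N.pos s).le, mul_comm]

theorem Scale.phase_add (N : Scale S) (x y : ℝ) (s : S) :
    N.phase (x + y) s = N.phase x s * N.phase y s := by
  simp only [Scale.phase_eq_exp, ← Complex.exp_add]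
  congr 1
  push_cast
  ring

/-- Continuous star homomorphisms on `C*(S)` are determined by the generators, where the phases
multiply. -/
theorem dynamics_dynamics (N : Scale S) (x y : ℝ) (a : SemigroupCStar S) :
    dynamics N x (dynamics N y a) = dynamics N (x + y) a := by
  have h : (dynamics N x).comp (dynamics N y) = dynamics N (x + y) := by
    refine StarAlgHom.ext_topologicalClosure (starAlgHom_continuous ((dynamics N x).comp (dynamics N y)))
      (starAlgHom_continuous (dynamics N (x + y))) (StarAlgHom.ext_adjoin ?_)
    rintro ⟨_, hx⟩ ⟨s, rfl⟩
    change dynamics N x (dynamics N y ((gen S).toFun s)) = dynamics N (x + y) ((gen S).toFun s)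
    rw [dynamics_gen, map_smul, dynamics_gen, dynamics_gen, smul_smul]
    congr 1
    rw [mul_comm]
    exact (N.phase_add x y s).symm
  exact congrArg (fun f => f a) h

theorem Rep.isStarProjection {A : Type*} [CStarAlgebra A] (v : Rep S A) (s : S) :
    IsStarProjection (v.toFun s * star (v.toFun s)) where
  isIdempotentElem := by
    change v.toFun s * star (v.toFun s) * (v.toFun s * star (v.toFun s)) = _
    rw [mul_assoc, ← mul_assoc (star _), v.isometry, one_mul]
  isSelfAdjoint := IsSelfAdjoint.mul_star_self _

/-- The generator `v_s` is an eigenvector with `h = log N(s)`. Taking `b = v_s*` moves `v_s` to the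
right, where `v_s* v_s = 1`. -/
theorem IsKMSState.apply_range_projection {N : Scale S} {β : ℝ} {φ : SemigroupCStar S →L[ℂ] ℂ}
    (hφ : IsKMSState (dynamics N) β φ) (s : S) :
    φ ((gen S).toFun s * star ((gen S).toFun s)) = ((N s ^ (-β) : ℝ) : ℂ) := by
  rw [hφ.apply_mul_of_eigenvector (dynamics_dynamics N) (h := Real.log (N s))
    (fun t => (dynamics_gen N t s).trans (by rw [← N.phase_eq_exp]; rfl)), (gen S).isometry,
    hφ.1.1, mul_one, Real.rpow_def_of_pos (N.pos s)]
  congr 2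
  ring

theorem IsKMSState.eq_zero_or_admissible [IsLeftCancelMul S] [IsRightLCM S] {N : Scale S}
    (hN : N.Nontrivial) {β : ℝ} {φ : SemigroupCStar S →L[ℂ] ℂ}
    (hφ : IsKMSState (dynamics N) β φ) : β = 0 ∨ (0 < β ∧ N.Admissible) := by
  have hproj := (gen S).isStarProjection
  refine N.eq_zero_or_admissible hN (fun s => ?_) fun s t ht => ?_
  · have h := hφ.1.nonneg_of_isStarProjection (hproj s).one_sub
    rw [map_sub, hφ.1.1, hφ.apply_range_projection, sub_nonneg] at h
    exact_mod_cast h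
  · have hφt : φ ((gen S).toFun t * star ((gen S).toFun t)) = 1 := by
      rw [hφ.apply_range_projection, N.rpow_eq_one_of_mem_ker ht, Complex.ofReal_one]
    rcases IsRightLCM.inter s t with h | ⟨r, hr⟩
    · have hst := (gen S).range_mul_eq_zero s t h
      -- The relation is used in both orders to see that the two range projections commute.
      have hts := (gen S).range_mul_eq_zero t s (by rwa [Set.inter_comm])
      have h1 := hφ.1.apply_mul_eq_of_apply_eq_one (hproj s) (hproj t) (hst.trans hts.symm) hφt
      rw [hst, map_zero, hφ.apply_range_projection] at h1
      exact absurd (Complex.ofReal_eq_zero.1 h1.symm) (Real.rpow_pos_of_pos (N.pos s) _).ne'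
    · have hst := (gen S).range_mul s t r hr
      have hts := (gen S).range_mul t s r (by rwa [Set.inter_comm])
      have h1 := hφ.1.apply_mul_eq_of_apply_eq_one (hproj s) (hproj t) (hst.trans hts.symm) hφt
      rw [hst, hφ.apply_range_projection, hφ.apply_range_projection] at h1
      exact ⟨r, hr, Complex.ofReal_injective h1⟩

end SemigroupKMS

end RightLCM

end

theorem mainTheorem4 {S : Type*} [Monoid S] [IsLeftCancelMul S] [RightLCM.IsRightLCM S]
    [Countable S] (N : RightLCM.Scale S) (hN : N.Nontrivial) (β : ℝ) :
    ((∃ μ : MeasureTheory.Measure (RightLCM.Character S),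
        MeasureTheory.IsProbabilityMeasure μ ∧ RightLCM.IsScaling N β μ) →
      β = 0 ∨ (0 < β ∧ N.Admissible)) ∧
    ((∃ φ : RightLCM.SemigroupCStar S →L[ℂ] ℂ,
        RightLCM.IsKMSState (RightLCM.dynamics N) β φ) →
      β = 0 ∨ (0 < β ∧ N.Admissible)) := by
  refine ⟨?_, ?_⟩
  · rintro ⟨μ, hμ, hscale⟩
    exact hscale.eq_zero_or_admissible hN
  · rintro ⟨φ, hφ⟩
    exact hφ.eq_zero_or_admissible hN
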